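/- Let $F$ be a finite abelian group, $N=F\oplus\mathbb Z^d$, and let $\pi\colon N\to N/F=\mathbb Z^d$ be the projection. Let $\mathcal A=\{\mathbf a_1,\dots,\mathbf a_n\}$ be a finite multiset of elements of $N$ and let $A=\{\bar{\mathbf a}_1,\dots,\bar{\mathbf a}_n\}$, $\bar{\mathbf a}_j=\pi(\mathbf a_j)$, be its image. Assume that $A$ generates $\mathbb Z^d$ as a group and that the cone $K_{\mathbb R}=\mathbb R_{\ge0}A\subseteq\mathbb R^d$ is pointed (that is, $x,-x\in K_{\mathbb R}$ implies $x=0$). Let $R=\mathbb C[\partial_1,\dots,\partial_n]$. Write $R_{\mathcal A}$ for $R$ with the $N$-grading $\deg\partial_j=\mathbf a_j$, and $R_A$ for $R$ with the $\mathbb Z^d$-grading $\deg\partial_j=\bar{\mathbf a}_j$. Let $$I_{\mathcal A}=R_{\mathcal A}\cdot\Big\{\partial^{\mathbf u}-\partial^{\mathbf v}\ \Big|\ \mathbf u,\mathbf v\in\mathbb N^n,\ \textstyle\sum_j(u_j-v_j)\mathbf a_j=0 \text{ in } N\Big\}.$$ Let $\ker(A)=\{x\in\mathbb Z^n\mid\sum_j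 x_j\bar{\mathbf a}_j=0\}$. For a face $\tau$ of $K_{\mathbb R}$ and a character $\rho\colon\ker(A)\to\mathbb C^*$ let $$I^\tau_{A,\rho}=R_A\cdot\Big(\{\partial_j\mid\bar{\mathbf a}_j\notin\tau\}\cup\{\partial^{\mathbf u}-\rho(\mathbf u-\mathbf v)\,\partial^{\mathbf v}\mid \mathbf u,\mathbf v\in\mathbb N^n,\ \mathbf u-\mathbf v\in\ker(A)\}\Big).$$ An $\mathcal A$-toric module is an $N$-graded $R_{\mathcal A}$-module $M$ having a finite filtration by $N$-graded submodules $0=M_0\subseteq M_1\subseteq\dots\subseteq M_r=M$ such that each composition factor $M_i/M_{i-1}$ is graded isomorphic to a shifted graded quotient of $R_{\mathcal A}/I_{\mathcal A}$. Write $\iota_\pi(M)$ for the same module over $R_A=R$ with the $\mathbb Z^d$-grading $\iota_\pi(M)_v=\bigoplus_{u\in\pi^{-1}(v)}M_u$. Then for every $\mathcal A$-toric module $M$, the $\mathbb Z^d$-graded $R_A$-module $\iota_\pi(M)$ is $A$-ttoric: it has a finite filtration by $\mathbb Z^d$-graded submodules such that each composition factor is graded isomorphic to a shifted copy of $R_A/I^\tau_{A,\rho}$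 for some face $\tau$ of $K_{\mathbb R}$ and some character $\rho\colon\ker(A)\to\mathbb C^*$, both depending on the composition factor. -/

import Mathlib

open MvPolynomial

namespace TorsionToric

/-! ### Modules over `ℂ[∂₁, …, ∂ₙ]` graded by an arbitrary abelian group

The polynomial ring `MvPolynomial (Fin n) ℂ` is graded by `G` through weights `w : Fin n → G`,
`deg ∂ⱼ = w j`. A graded module is a module together with the family of its graded pieces. -/

section Graded

variable {n : ℕ} {G : Type*} [AddCommGroup G]

/-- The `w`-grading of the polynomial ring: `(polyGrading w) u` is the set of polynomials all of
whose monomials have degree `u`. -/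
noncomputable def polyGrading (w : Fin n → G) (u : G) : AddSubgroup (MvPolynomial (Fin n) ℂ) :=
  (weightedHomogeneousSubmodule ℂ w u).toAddSubgroup

/-- `ℳ` makes `M` a `G`-graded module over the polynomial ring graded by `w`. -/
structure IsGradedModule [DecidableEq G] (w : Fin n → G) {M : Type*} [AddCommGroup M]
    [Module (MvPolynomial (Fin n) ℂ) M] (ℳ : G → AddSubgroup M) : Prop where
  isInternal : DirectSum.IsInternal ℳ
  smul_mem : ∀ {u v : G} {r : MvPolynomial (Fin n) ℂ} {m : M},
    r ∈ polyGrading w u → m ∈ ℳ v → r • m ∈ ℳ (u + v)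

variable {R : Type*} [CommRing R] {M M' : Type*} [AddCommGroup M] [Module R M]
  [AddCommGroup M'] [Module R M']

/-- A graded submodule: `P = ∑ᵤ (Mᵤ ∩ P)`, i.e. `P` is generated by homogeneous elements. -/
def IsGradedSubmodule (ℳ : G → AddSubgroup M) (P : Submodule R M) : Prop :=
  P.toAddSubgroup = ⨆ u, ℳ u ⊓ P.toAddSubgroup

/-- The induced grading on a submodule, `Pᵤ = Mᵤ ∩ P`. -/
def subGrading (ℳ : G → AddSubgroup M) (P : Submodule R M) (u : G) : AddSubgroup P :=
  (ℳ u).comap P.subtype.toAddMonoidHom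

/-- The induced grading on a quotient, `(M/P)ᵤ =` image of `Mᵤ`. -/
def quotGrading (ℳ : G → AddSubgroup M) (P : Submodule R M) (u : G) : AddSubgroup (M ⧸ P) :=
  (ℳ u).map P.mkQ.toAddMonoidHom

/-- The shifted grading, `M(s)ᵤ = Mᵤ₊ₛ`. -/
def shiftGrading (s : G) (ℳ : G → AddSubgroup M) (u : G) : AddSubgroup M := ℳ (u + s)

/-- There is an `R`-linear isomorphism that respects the gradings in both directions. -/
def GradedIso (R : Type*) [CommRing R] {M M' : Type*} [AddCommGroup M] [Module R M]
    [AddCommGroup M'] [Module R M'] (ℳ : G → AddSubgroup M) (ℳ' : G → AddSubgroup M') : Prop :=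
  ∃ e : M ≃ₗ[R] M', ∀ (u : G) (x : M), x ∈ ℳ u ↔ e x ∈ ℳ' u

/-- `M` has a finite filtration `0 = P₀ ⊆ P₁ ⊆ ⋯ ⊆ Pᵣ = M` by graded submodules such that each
composition factor `Pᵢ₊₁/Pᵢ`, with its induced grading, is graded isomorphic to a shifted copy of
`R/J` for an ideal `J` satisfying `𝒥` (where `R/J` carries the grading induced by `𝓡`). -/
def HasGradedFiltration (𝓡 : G → AddSubgroup R) (𝒥 : Ideal R → Prop) (ℳ : G → AddSubgroup M) :
    Prop :=
  ∃ (r : ℕ) (P : ℕ → Submodule R M), P 0 = ⊥ ∧ P r = ⊤ ∧ Monotone P ∧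
    (∀ i, IsGradedSubmodule ℳ (P i)) ∧
    ∀ i < r, ∃ (J : Ideal R) (s : G), 𝒥 J ∧
      GradedIso R (shiftGrading s (quotGrading 𝓡 J))
        (quotGrading (subGrading ℳ (P (i + 1))) ((P i).submoduleOf (P (i + 1))))

end Graded

/-! ### Binomial ideals -/

section Ideals

variable {n : ℕ} {G : Type*} [AddCommGroup G]

/-- The lattice of integer relations `{x ∈ ℤⁿ | ∑ⱼ xⱼ • aⱼ = 0}` among `a₁, …, aₙ`. -/
noncomputable def relationLattice (a : Fin n → G) : Submodule ℤ (Fin n → ℤ) :=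
  LinearMap.ker (Fintype.linearCombination ℤ a)

/-- The difference `u - v ∈ ℤⁿ` of two exponent vectors. -/
def expDiff (u v : Fin n →₀ ℕ) : Fin n → ℤ := fun j => (u j : ℤ) - (v j : ℤ)

/-- The toric ideal generated by all `∂ᵘ - ∂ᵛ` with `a · (u - v) = 0`. -/
noncomputable def toricIdeal (a : Fin n → G) : Ideal (MvPolynomial (Fin n) ℂ) :=
  Ideal.span {p | ∃ u v : Fin n →₀ ℕ, expDiff u v ∈ relationLattice a ∧
    p = monomial u 1 - monomial v 1}

/-- The ideal `I₊(ρ)` of a partial character `ρ : L → ℂ*`, `L ⊆ ℤⁿ`: it is generated by all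
`∂ᵘ - ρ(u - v) ∂ᵛ` with `u - v ∈ L`. -/
noncomputable def characterIdeal (L : Submodule ℤ (Fin n → ℤ)) (ρ : AddChar L ℂˣ) :
    Ideal (MvPolynomial (Fin n) ℂ) :=
  Ideal.span {p | ∃ (u v : Fin n →₀ ℕ) (h : expDiff u v ∈ L),
    p = monomial u 1 - monomial v ((ρ ⟨expDiff u v, h⟩ : ℂˣ) : ℂ)}

end Ideals

/-! ### The group `N = F ⊕ ℤᵈ`, its free quotient `ℤᵈ`, and the cone of `A` -/

section Setup

variable {n d : ℕ} {F : Type*} [AddCommGroup F]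

/-- The projection `π : N = F ⊕ ℤᵈ → ℤᵈ`. -/
def proj (F : Type*) [AddCommGroup F] (d : ℕ) : F × (Fin d → ℤ) →+ (Fin d → ℤ) :=
  AddMonoidHom.snd F (Fin d → ℤ)

/-- The inclusion `ℤᵈ ⊆ ℝᵈ`. -/
def toReal (x : Fin d → ℤ) : Fin d → ℝ := fun i => (x i : ℝ)

/-- The real cone `ℝ≥0 · A` generated by vectors `A₁, …, Aₙ ∈ ℤᵈ`. -/
noncomputable def realCone (A : Fin n → Fin d → ℤ) : PointedCone ℝ (Fin d → ℝ) :=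
  PointedCone.hull ℝ (Set.range fun j => toReal (A j))

/-- The ideal `I^τ_{A,ρ}` of a face `τ` of the cone of `A` and a character `ρ` of `ker A`: it is
generated by the variables `∂ⱼ` with `Aⱼ ∉ τ` and by `I₊(ρ)`. -/
noncomputable def faceIdeal (A : Fin n → Fin d → ℤ) (τ : PointedCone ℝ (Fin d → ℝ))
    (ρ : AddChar (relationLattice A) ℂˣ) : Ideal (MvPolynomial (Fin n) ℂ) :=
  Ideal.span {p | ∃ j : Fin n, toReal (A j) ∉ τ ∧ p = X j} ⊔ characterIdeal (relationLattice A) ρ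

/-- The grading of `ι_π(M)` along a homomorphism `π` of grading groups: the piece of degree `v` is
the sum of all pieces `Mᵤ` with `π u = v`. -/
def coarsen {G H : Type*} [AddCommGroup G] [AddCommGroup H] (π : G →+ H) {M : Type*}
    [AddCommGroup M] (ℳ : G → AddSubgroup M) (v : H) : AddSubgroup M :=
  ⨆ u : {u : G // π u = v}, ℳ u

variable {M : Type*} [AddCommGroup M] [Module (MvPolynomial (Fin n) ℂ) M]

/-- An `𝒜`-toric module: a graded module with a finite graded filtration whose composition factors
are shifted graded quotients of `R_𝒜/I_𝒜`, that is, shifted copies of `R_𝒜/J` with `J` a graded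
ideal containing `I_𝒜`. -/
def IsToric {G : Type*} [AddCommGroup G] [DecidableEq G] (a : Fin n → G) (ℳ : G → AddSubgroup M) :
    Prop :=
  IsGradedModule a ℳ ∧
    HasGradedFiltration (polyGrading a)
      (fun J => toricIdeal a ≤ J ∧ IsGradedSubmodule (polyGrading a) J) ℳ

/-- An `A`-ttoric module: a graded module with a finite graded filtration whose composition factors
are shifted copies of `R_A/I^τ_{A,ρ}`, for faces `τ` of the cone of `A` and characters `ρ` of
`ker A`. -/
def IsTtoric (A : Fin n → Fin d → ℤ) (ℳ : (Fin d → ℤ) → AddSubgroup M) : Prop :=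
  IsGradedModule A ℳ ∧
    HasGradedFiltration (polyGrading A)
      (fun J => ∃ (τ : PointedCone ℝ (Fin d → ℝ)) (ρ : AddChar (relationLattice A) ℂˣ),
        τ.IsFaceOf (realCone A) ∧ J = faceIdeal A τ ρ) ℳ

end Setup

end TorsionToric

/-!
The coarse grading of `ι_π(M)` is again a grading, and `M` is Noetherian, being filtered by cyclic
modules. Hence `M` has a graded prime filtration (`hasGradedFiltration_of_isNoetherian`): its
factors are shifts of `R/J`, where `J = (P : x)` is maximal among these ideals for homogeneous
elements `x` outside of the previous step `P`. Such a `J` is proper, graded, and satisfies the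
condition `pq ∈ J → p ∈ J ∨ q ∈ J` for homogeneous `p, q` (`IsGradedPrime`); this is all that is
used about it, so that no ordering of `ℤᵈ` is needed to see that `J` is prime. As every binomial
of the toric ideal `I_𝒜` acts nilpotently on `M`, it lies in `J`.

It remains to see that a graded prime `J` containing `I_𝒜` is some `I^τ_{A,ρ}`
(`IsGradedPrime.exists_eq_faceIdeal`). Put `N = |F|`. If `∂ᵘ` and `∂ᵛ` have the same degree in
`ℤᵈ`, then `N(u - v)` is a relation among the elements of `𝒜`, so that
`∂^{Nu} - ∂^{Nv} = ∏_ζ (∂ᵘ - ζ ∂ᵛ)`, a product over the `N`-th roots of unity, lies in `J`. This has two consequences.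

* `∂ᵘ ∈ J` if and only if `∂ᵛ ∈ J`. Therefore the generators `Aⱼ` with `∂ⱼ ∉ J` form a face of the
  semigroup `ℕA`. They span a face `τ` of the real cone that contains no other generator
  (`exists_isFaceOf_realCone`): a real relation becomes a rational one with the same supports by
  applying a `ℚ`-linear map `ℝ → ℚ` that is positive on its finitely many positive coefficients.
* `∂ᵘ - ζ ∂ᵛ ∈ J` for some `ζ`, which is unique if `∂ᵛ ∉ J`. The numbers `ζ` depend
  multiplicatively on `u - v` and form a character of the relations supported on `τ`; it extends
  to a character `ρ` of `ker A` because `ℂˣ` is divisible (`IsGradedPrime.exists_character`).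

The generators of `I^τ_{A,ρ}` thus lie in `J`. Conversely, a homogeneous element of `J` is modulo
`I^τ_{A,ρ}` a multiple of one monomial, and a nonzero multiple of a monomial in `J` is divisible
by a variable in `J`.
-/

namespace TorsionToric

/-! ### Homogeneous components -/

section Components

variable {G : Type*} [DecidableEq G] {M : Type*} [AddCommGroup M]

/-- The projection of `M = ⨁ ℳ u` onto the homogeneous component of degree `u`. -/
noncomputable def component {ℳ : G → AddSubgroup M} (h : DirectSum.IsInternal ℳ) (u : G) :
    M →+ M :=
  ((ℳ u).subtype.comp (DFinsupp.evalAddMonoidHom u)).comp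
    (AddEquiv.ofBijective (DirectSum.coeAddMonoidHom ℳ) h).symm.toAddMonoidHom

lemma component_coe {ℳ : G → AddSubgroup M} (h : DirectSum.IsInternal ℳ) (u : G)
    (x : DirectSum G fun i => ℳ i) : component h u (DirectSum.coeAddMonoidHom ℳ x) = x u := by
  have : (AddEquiv.ofBijective (DirectSum.coeAddMonoidHom ℳ) h).symm
      (DirectSum.coeAddMonoidHom ℳ x) = x :=
    (AddEquiv.ofBijective (DirectSum.coeAddMonoidHom ℳ) h).symm_apply_apply x
  simp only [component, AddMonoidHom.comp_apply, AddEquiv.toAddMonoidHom_eq_coe,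
    AddMonoidHom.coe_coe, this]
  rfl

lemma component_mem {ℳ : G → AddSubgroup M} (h : DirectSum.IsInternal ℳ) (u : G) (m : M) :
    component h u m ∈ ℳ u := by
  obtain ⟨x, rfl⟩ := h.2 m
  rw [component_coe]
  exact (x u).2

lemma component_of_mem {ℳ : G → AddSubgroup M} (h : DirectSum.IsInternal ℳ) {u : G} {m : M}
    (hm : m ∈ ℳ u) : component h u m = m := by
  have := component_coe h u (DirectSum.of (fun i => ℳ i) u ⟨m, hm⟩)
  rwa [DirectSum.coeAddMonoidHom_of, DirectSum.of_eq_same] at this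

lemma component_of_mem_of_ne {ℳ : G → AddSubgroup M} (h : DirectSum.IsInternal ℳ) {u v : G}
    (huv : v ≠ u) {m : M} (hm : m ∈ ℳ v) : component h u m = 0 := by
  have := component_coe h u (DirectSum.of (fun i => ℳ i) v ⟨m, hm⟩)
  rwa [DirectSum.coeAddMonoidHom_of, DirectSum.of_eq_of_ne _ _ _ huv.symm] at this

lemma iSup_eq_top_of_isInternal {ℳ : G → AddSubgroup M} (h : DirectSum.IsInternal ℳ) :
    ⨆ u, ℳ u = ⊤ := by
  refine eq_top_iff.2 fun m _ => ?_
  obtain ⟨x, rfl⟩ := h.2 m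
  induction x using DirectSum.induction_on with
  | zero => simp
  | of i x =>
    rw [DirectSum.coeAddMonoidHom_of]
    exact AddSubgroup.mem_iSup_of_mem i x.2
  | add x y hx hy =>
    rw [map_add]
    exact add_mem (hx trivial) (hy trivial)

/-- A family of subgroups spanning `M` that is separated by projections is a grading. -/
lemma isInternal_of_projections {ℳ : G → AddSubgroup M} (c : G → M →+ M)
    (h₁ : ∀ u, ∀ m ∈ ℳ u, c u m = m) (h₂ : ∀ u v, v ≠ u → ∀ m ∈ ℳ v, c u m = 0)
    (h₃ : ⨆ u, ℳ u = ⊤) : DirectSum.IsInternal ℳ := by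
  have key : ∀ u (x : DirectSum G fun i => ℳ i), c u (DirectSum.coeAddMonoidHom ℳ x) = x u := by
    intro u x
    induction x using DirectSum.induction_on with
    | zero => simp
    | of i x =>
      rw [DirectSum.coeAddMonoidHom_of]
      by_cases hi : i = u
      · subst hi
        rw [h₁ _ _ x.2, DirectSum.of_eq_same]
      · rw [h₂ _ _ hi _ x.2, DirectSum.of_eq_of_ne _ _ _ (Ne.symm hi)]
        rfl
    | add x y hx hy => rw [map_add, map_add, hx, hy]; rfl
  refine ⟨(injective_iff_map_eq_zero _).2 fun x hx => ?_, ?_⟩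
  · refine DFinsupp.ext fun u => Subtype.ext ?_
    have := key u x
    rw [hx, map_zero] at this
    exact this.symm
  · rw [← AddMonoidHom.range_eq_top, eq_top_iff, ← h₃]
    refine iSup_le fun u m hm => ⟨DirectSum.of (fun i => ℳ i) u ⟨m, hm⟩, ?_⟩
    rw [DirectSum.coeAddMonoidHom_of]

lemma isInternal_coarsen [AddCommGroup G] {H : Type*} [AddCommGroup H] [DecidableEq H] (π : G →+ H)
    {ℳ : G → AddSubgroup M} (h : DirectSum.IsInternal ℳ) :
    DirectSum.IsInternal (coarsen π ℳ) := by
  have hmem : ∀ u, ℳ u ≤ coarsen π ℳ (π u) := fun u =>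
    le_iSup (fun w : {w : G // π w = π u} => ℳ w) ⟨u, rfl⟩
  let e := AddEquiv.ofBijective (DirectSum.coeAddMonoidHom ℳ) h
  -- The projection to degree `v` keeps the components whose degree lies over `v`.
  let c : H → M →+ M := fun v => ((DirectSum.coeAddMonoidHom ℳ).comp
    (DFinsupp.filterAddMonoidHom (fun i => ℳ i) fun u => π u = v)).comp e.symm.toAddMonoidHom
  have hc : ∀ v u (m : M) (hm : m ∈ ℳ u), c v m = if π u = v then m else 0 := by
    intro v u m hm
    have hsymm : e.symm m = DirectSum.of (fun i => ℳ i) u ⟨m, hm⟩ := by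
      rw [AddEquiv.symm_apply_eq]
      exact (DirectSum.coeAddMonoidHom_of ℳ u ⟨m, hm⟩).symm
    change DirectSum.coeAddMonoidHom ℳ (DFinsupp.filter (fun u => π u = v) (e.symm m)) = _
    rw [hsymm]
    change DirectSum.coeAddMonoidHom ℳ
      (DFinsupp.filter (fun u => π u = v) (DFinsupp.single u ⟨m, hm⟩)) = _
    rw [DFinsupp.filter_single]
    split_ifs
    · exact DirectSum.coeAddMonoidHom_of ℳ u ⟨m, hm⟩
    · rw [map_zero]
  refine isInternal_of_projections c (fun v m hm => ?_) (fun v w hvw m hm => ?_) ?_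
  · refine AddSubgroup.iSup_induction (C := fun m => c v m = m) _ hm ?_ (map_zero _) ?_
    · rintro ⟨u, rfl⟩ x hx
      rw [hc _ u x hx, if_pos rfl]
    · intro x y hx hy
      rw [map_add, hx, hy]
  · refine AddSubgroup.iSup_induction (C := fun m => c v m = 0) _ hm ?_ (map_zero _) ?_
    · rintro ⟨u, rfl⟩ x hx
      rw [hc _ u x hx, if_neg hvw]
    · intro x y hx hy
      rw [map_add, hx, hy, add_zero]
  · rw [eq_top_iff, ← iSup_eq_top_of_isInternal h]
    exact iSup_le fun u => (hmem u).trans (le_iSup (coarsen π ℳ) (π u))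

lemma isGradedSubmodule_of_component_mem {R : Type*} [CommRing R] [Module R M]
    {ℳ : G → AddSubgroup M} (h : DirectSum.IsInternal ℳ) {P : Submodule R M}
    (hP : ∀ m ∈ P, ∀ u, component h u m ∈ P) : IsGradedSubmodule ℳ P := by
  classical
  refine le_antisymm (fun m hm => ?_) (iSup_le fun u => inf_le_right)
  obtain ⟨x, rfl⟩ := h.2 m
  rw [DirectSum.coeAddMonoidHom_eq_dfinsuppSum]
  refine sum_mem fun u _ => AddSubgroup.mem_iSup_of_mem u ⟨(x u).2, ?_⟩
  have hu := hP _ hm u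
  rw [component_coe] at hu
  exact hu

lemma component_mem_of_isGradedSubmodule {R : Type*} [CommRing R] [Module R M]
    {ℳ : G → AddSubgroup M} (h : DirectSum.IsInternal ℳ)
    {P : Submodule R M}
    (hP : IsGradedSubmodule ℳ P) {m : M} (hm : m ∈ P) (u : G) : component h u m ∈ P := by
  have hm' : m ∈ ⨆ u, ℳ u ⊓ P.toAddSubgroup := by rw [← hP]; exact hm
  refine AddSubgroup.iSup_induction (C := fun m => component h u m ∈ P) _ hm' ?_ ?_ ?_
  · rintro v x ⟨hx, hxP⟩
    by_cases hv : v = u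
    · subst hv
      rw [component_of_mem h hx]; exact hxP
    · rw [component_of_mem_of_ne h hv hx]; exact zero_mem _
  · rw [map_zero]; exact zero_mem _
  · intro x y hx hy
    rw [map_add]; exact add_mem hx hy

end Components

section GradedModules

variable {n : ℕ} {G : Type*} [AddCommGroup G] {w : Fin n → G}

lemma weight_comp {H : Type*} [AddCommGroup H] (π : G →+ H) (w : Fin n → G)
    (u : Fin n →₀ ℕ) :
    Finsupp.weight (fun j => π (w j)) u = π (Finsupp.weight w u) := by
  simp [Finsupp.weight_apply, Finsupp.sum]

lemma monomial_mem_polyGrading (s : Fin n →₀ ℕ) (z : ℂ) :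
    monomial s z ∈ polyGrading w (Finsupp.weight w s) :=
  isWeightedHomogeneous_monomial w s z rfl

variable [DecidableEq G] {M : Type*} [AddCommGroup M] [Module (MvPolynomial (Fin n) ℂ) M]
  {ℳ : G → AddSubgroup M}

lemma IsGradedModule.coarsen {H : Type*} [AddCommGroup H] [DecidableEq H] (π : G →+ H)
    (h : IsGradedModule w ℳ) : IsGradedModule (fun j => π (w j)) (coarsen π ℳ) where
  isInternal := isInternal_coarsen π h.isInternal
  smul_mem := by
    intro u v r m hr hm
    rw [← support_sum_monomial_coeff r, Finset.sum_smul]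
    refine sum_mem fun s hs => ?_
    have hs' : π (Finsupp.weight w s) = u := by
      rw [← weight_comp]; exact hr (mem_support_iff.1 hs)
    refine AddSubgroup.iSup_induction
      (C := fun m => monomial s (coeff s r) • m ∈ TorsionToric.coarsen π ℳ (u + v)) _ hm ?_ ?_ ?_
    · rintro ⟨t, rfl⟩ x hx
      refine le_iSup (fun t' : {t' : G // π t' = u + π t} => ℳ t')
        ⟨Finsupp.weight w s + t, by rw [map_add, hs']⟩ ?_
      exact h.smul_mem (monomial_mem_polyGrading s _) hx
    · rw [smul_zero]; exact zero_mem _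
    · intro x y hx hy
      rw [smul_add]; exact add_mem hx hy

/-- On multiples of an element of degree `t`, taking components is taking weighted homogeneous
components of the coefficient. -/
lemma component_smul (h : IsGradedModule w ℳ) {t : G} {x : M} (hx : x ∈ ℳ t) (u : G)
    (r : MvPolynomial (Fin n) ℂ) :
    component h.isInternal u (r • x) = weightedHomogeneousComponent w (u - t) r • x := by
  induction r using MvPolynomial.induction_on' with
  | monomial s z =>
    have hs := h.smul_mem (monomial_mem_polyGrading (w := w) s z) hx
    by_cases hu : Finsupp.weight w s + t = u
    · rw [weightedHomogeneousComponent_of_mem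
        (n := Finsupp.weight w s) (monomial_mem_polyGrading s z),
        if_pos (by rw [← hu, add_sub_cancel_right])]
      exact component_of_mem _ (hu ▸ hs)
    · rw [weightedHomogeneousComponent_of_mem
        (n := Finsupp.weight w s) (monomial_mem_polyGrading s z),
        if_neg (fun e => hu (by rw [← e, sub_add_cancel])), zero_smul]
      exact component_of_mem_of_ne _ hu hs
  | add p q hp hq => rw [add_smul, map_add, hp, hq, map_add, add_smul]

end GradedModules

/-! ### Filtrations by graded primes -/

section Filtration

variable {n : ℕ} {G : Type*} [AddCommGroup G]

/-- A proper ideal that is closed under taking homogeneous components and satisfies the defining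
property of a prime ideal for homogeneous elements. -/
structure IsGradedPrime (w : Fin n → G) (J : Ideal (MvPolynomial (Fin n) ℂ)) : Prop where
  ne_top : J ≠ ⊤
  component_mem : ∀ r ∈ J, ∀ u, weightedHomogeneousComponent w u r ∈ J
  mem_or_mem : ∀ {u v : G} {p q : MvPolynomial (Fin n) ℂ}, p ∈ polyGrading w u →
    q ∈ polyGrading w v → p * q ∈ J → p ∈ J ∨ q ∈ J

lemma IsGradedPrime.one_notMem {w : Fin n → G} {J : Ideal (MvPolynomial (Fin n) ℂ)}
    (hJ : IsGradedPrime w J) : (1 : MvPolynomial (Fin n) ℂ) ∉ J :=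
  fun h => hJ.ne_top ((Ideal.eq_top_iff_one J).2 h)

lemma IsGradedPrime.mem_of_pow_mem {w : Fin n → G} {J : Ideal (MvPolynomial (Fin n) ℂ)}
    (hJ : IsGradedPrime w J) {u : G} {p : MvPolynomial (Fin n) ℂ} (hp : p ∈ polyGrading w u)
    {r : ℕ} (h : p ^ r ∈ J) : p ∈ J := by
  induction r with
  | zero => exact absurd (by simpa using h) hJ.one_notMem
  | succ r ih =>
    rw [pow_succ] at h
    exact (hJ.mem_or_mem (IsWeightedHomogeneous.pow hp r) hp h).elim ih id

lemma IsGradedPrime.exists_mem_of_prod_mem {w : Fin n → G} {J : Ideal (MvPolynomial (Fin n) ℂ)}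
    (hJ : IsGradedPrime w J) {ι : Type*} {s : Finset ι} {f : ι → MvPolynomial (Fin n) ℂ}
    {d : ι → G} (hf : ∀ i ∈ s, f i ∈ polyGrading w (d i)) (h : ∏ i ∈ s, f i ∈ J) :
    ∃ i ∈ s, f i ∈ J := by
  classical
  induction s using Finset.induction_on with
  | empty => exact absurd (by simpa using h) hJ.one_notMem
  | insert i s his ih =>
    rw [Finset.prod_insert his] at h
    rcases hJ.mem_or_mem (hf i (Finset.mem_insert_self i s))
      (IsWeightedHomogeneous.prod s f d fun j hj => hf j (Finset.mem_insert_of_mem hj)) h with h | h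
    · exact ⟨i, Finset.mem_insert_self i s, h⟩
    · obtain ⟨j, hj, hjJ⟩ := ih (fun j hj => hf j (Finset.mem_insert_of_mem hj)) h
      exact ⟨j, Finset.mem_insert_of_mem hj, hjJ⟩

variable {M : Type*} [AddCommGroup M] [Module (MvPolynomial (Fin n) ℂ) M]
  {w : Fin n → G} {ℳ : G → AddSubgroup M}

/-- Every module with a finite filtration by cyclic composition factors is Noetherian. -/
lemma HasGradedFiltration.isNoetherian {𝓡 : G → AddSubgroup (MvPolynomial (Fin n) ℂ)}
    {𝒥 : Ideal (MvPolynomial (Fin n) ℂ) → Prop} (h : HasGradedFiltration 𝓡 𝒥 ℳ) :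
    IsNoetherian (MvPolynomial (Fin n) ℂ) M := by
  obtain ⟨r, P, h0, hr, hmono, -, hfac⟩ := h
  have key : ∀ i ≤ r, IsNoetherian (MvPolynomial (Fin n) ℂ) (P i) := by
    intro i
    induction i with
    | zero => intro _; rw [h0]; infer_instance
    | succ i ih =>
      intro hi
      obtain ⟨J, s, -, e, -⟩ := hfac i hi
      have := ih (Nat.le_of_succ_le hi)
      have : IsNoetherian (MvPolynomial (Fin n) ℂ) (P i |>.submoduleOf (P (i + 1))) :=
        isNoetherian_of_linearEquiv (Submodule.submoduleOfEquivOfLe (hmono i.le_succ)).symm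
      have := isNoetherian_of_linearEquiv e
      exact (isNoetherian_iff_submodule_quotient ((P i).submoduleOf (P (i + 1)))).2
        ⟨inferInstance, inferInstance⟩
  have := key r le_rfl
  rw [hr] at this
  exact isNoetherian_top_iff.1 this

/-- An element that kills every composition factor of a filtration of length `r` acts nilpotently,
with exponent `r`. -/
lemma HasGradedFiltration.exists_pow_smul_eq_zero
    {𝓡 : G → AddSubgroup (MvPolynomial (Fin n) ℂ)}
    {𝒥 : Ideal (MvPolynomial (Fin n) ℂ) → Prop} (h : HasGradedFiltration 𝓡 𝒥 ℳ)
    {f : MvPolynomial (Fin n) ℂ} (hf : ∀ J, 𝒥 J → f ∈ J) : ∃ r : ℕ, ∀ m : M, f ^ r • m = 0 := by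
  obtain ⟨r, P, h0, hr, -, -, hfac⟩ := h
  have key : ∀ i ≤ r, ∀ m ∈ P i, f ^ i • m = 0 := by
    intro i
    induction i with
    | zero =>
      intro _ m hm
      rw [h0] at hm
      rw [(Submodule.mem_bot _).1 hm, smul_zero]
    | succ i ih =>
      intro hi m hm
      obtain ⟨J, s, hJ, e, -⟩ := hfac i hi
      have hzero : ∀ y : MvPolynomial (Fin n) ℂ ⧸ J, f • y = 0 := by
        intro y
        obtain ⟨y, rfl⟩ := Submodule.mkQ_surjective _ y
        rw [← map_smul]
        exact (Submodule.Quotient.mk_eq_zero _).2 (J.mul_mem_right y (hf J hJ))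
      have hmem : f • m ∈ P i := by
        have h1 : f • ((P i).submoduleOf (P (i + 1))).mkQ ⟨m, hm⟩ = 0 := by
          rw [← e.apply_symm_apply (((P i).submoduleOf (P (i + 1))).mkQ ⟨m, hm⟩), ← map_smul,
            hzero, map_zero]
        rw [← map_smul] at h1
        exact (Submodule.Quotient.mk_eq_zero ((P i).submoduleOf (P (i + 1)))).1 h1
      rw [pow_succ, mul_smul]
      exact ih (Nat.le_of_succ_le hi) _ hmem
  exact ⟨r, fun m => key r le_rfl m (hr ▸ Submodule.mem_top)⟩

variable [DecidableEq G]

/-- The graded version of the existence of associated primes: a maximal element among the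
annihilators of the nonzero homogeneous elements of `M ⧸ P` is a graded prime. -/
lemma exists_isGradedPrime_colon (h : IsGradedModule w ℳ)
    {P : Submodule (MvPolynomial (Fin n) ℂ) M} (hP : IsGradedSubmodule ℳ P) (hPtop : P ≠ ⊤) :
    ∃ (t : G) (x : M), x ∈ ℳ t ∧ x ∉ P ∧ IsGradedPrime w (P.colon {x}) := by
  let S : Set (Ideal (MvPolynomial (Fin n) ℂ)) :=
    {J | ∃ (t : G) (x : M), x ∈ ℳ t ∧ x ∉ P ∧ J = P.colon {x}}
  have hS : S.Nonempty := by
    by_contra hS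
    refine hPtop (eq_top_iff.2 fun m _ => ?_)
    have : (⨆ u, ℳ u) ≤ P.toAddSubgroup := iSup_le fun u x hx => by
      by_contra hxP
      exact hS ⟨_, u, x, hx, hxP, rfl⟩
    rw [iSup_eq_top_of_isInternal h.isInternal] at this
    exact this (AddSubgroup.mem_top m)
  obtain ⟨J, ⟨t, x, hx, hxP, rfl⟩, hmax⟩ := set_has_maximal_iff_noetherian.2 inferInstance S hS
  refine ⟨t, x, hx, hxP, ?_, ?_, ?_⟩
  · intro htop
    have : (1 : MvPolynomial (Fin n) ℂ) ∈ P.colon {x} := htop ▸ Submodule.mem_top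
    rw [Submodule.mem_colon_singleton, one_smul] at this
    exact hxP this
  · intro r hr u
    rw [Submodule.mem_colon_singleton] at hr ⊢
    have := component_mem_of_isGradedSubmodule h.isInternal hP hr (u + t)
    rwa [component_smul h hx, add_sub_cancel_right] at this
  · intro u v p q hp hq hpq
    by_contra! hcon
    rw [Submodule.mem_colon_singleton] at hpq
    have hqx : q • x ∉ P := fun hq' => hcon.2 (Submodule.mem_colon_singleton.2 hq')
    refine hmax (P.colon {q • x}) ⟨_, q • x, h.smul_mem hq hx, hqx, rfl⟩
      (lt_of_le_of_ne (fun r hr => ?_) fun heq => ?_)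
    · rw [Submodule.mem_colon_singleton] at hr ⊢
      rw [smul_comm]
      exact P.smul_mem q hr
    · refine hcon.1 ?_
      rw [heq, Submodule.mem_colon_singleton, smul_smul]
      exact hpq

lemma isGradedSubmodule_sup_span (h : IsGradedModule w ℳ)
    {P : Submodule (MvPolynomial (Fin n) ℂ) M} (hP : IsGradedSubmodule ℳ P) {t : G} {x : M}
    (hx : x ∈ ℳ t) :
    IsGradedSubmodule ℳ (P ⊔ Submodule.span (MvPolynomial (Fin n) ℂ) {x}) := by
  refine isGradedSubmodule_of_component_mem h.isInternal fun m hm u => ?_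
  obtain ⟨p, hp, y, hy, rfl⟩ := Submodule.mem_sup.1 hm
  obtain ⟨r, rfl⟩ := Submodule.mem_span_singleton.1 hy
  rw [map_add, component_smul h hx]
  exact Submodule.add_mem_sup (component_mem_of_isGradedSubmodule h.isInternal hP hp u)
    (Submodule.smul_mem _ _ (Submodule.mem_span_singleton_self x))

/-- For `x` of degree `t`, the composition factor `(P + Rx) / P` is the shift by `-t` of the cyclic
module `R / (P : x)`. -/
lemma gradedIso_sup_span (h : IsGradedModule w ℳ)
    {P : Submodule (MvPolynomial (Fin n) ℂ) M} (hP : IsGradedSubmodule ℳ P) {t : G} {x : M}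
    (hx : x ∈ ℳ t) {P' : Submodule (MvPolynomial (Fin n) ℂ) M}
    (hP' : P' = P ⊔ Submodule.span (MvPolynomial (Fin n) ℂ) {x}) :
    GradedIso (MvPolynomial (Fin n) ℂ)
      (shiftGrading (-t) (quotGrading (polyGrading w) (P.colon {x})))
      (quotGrading (subGrading ℳ P') (P.submoduleOf P')) := by
  have hxP' : x ∈ P' := hP' ▸ Submodule.mem_sup_right (Submodule.mem_span_singleton_self x)
  let g : MvPolynomial (Fin n) ℂ →ₗ[MvPolynomial (Fin n) ℂ] P' ⧸ P.submoduleOf P' :=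
    (P.submoduleOf P').mkQ ∘ₗ LinearMap.toSpanSingleton _ P' ⟨x, hxP'⟩
  have hg : ∀ r, g r = (P.submoduleOf P').mkQ (r • ⟨x, hxP'⟩) := fun _ => rfl
  have hker : P.colon {x} = LinearMap.ker g := by
    ext r
    rw [Submodule.mem_colon_singleton, LinearMap.mem_ker, hg, Submodule.mkQ_apply,
      Submodule.Quotient.mk_eq_zero]
    rfl
  have hsurj : Function.Surjective g := by
    intro y
    obtain ⟨⟨y, hy⟩, rfl⟩ := Submodule.mkQ_surjective _ y
    have hy' := hy
    rw [hP'] at hy'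
    obtain ⟨p, hp, z, hz, rfl⟩ := Submodule.mem_sup.1 hy'
    obtain ⟨r, rfl⟩ := Submodule.mem_span_singleton.1 hz
    refine ⟨r, ?_⟩
    rw [hg, Submodule.mkQ_apply, Submodule.mkQ_apply, Submodule.Quotient.eq]
    change r • x - (p + r • x) ∈ P
    rw [sub_add_cancel_right]
    exact neg_mem hp
  let e := (Submodule.quotEquivOfEq _ _ hker).trans (g.quotKerEquivOfSurjective hsurj)
  have he : ∀ r, e (Submodule.mkQ _ r) = g r := fun _ => rfl
  refine ⟨e, fun u y => ?_⟩
  obtain ⟨r, rfl⟩ := Submodule.mkQ_surjective _ y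
  rw [he]
  constructor
  · rintro ⟨r', hr', hrr'⟩
    have hgr : g r' = g r := by rw [← he, ← he]; exact congrArg e hrr'
    rw [← hgr]
    refine ⟨r' • ⟨x, hxP'⟩, ?_, rfl⟩
    have := h.smul_mem hr' hx
    rw [neg_add_cancel_right] at this
    exact this
  · rintro ⟨⟨y, hyP'⟩, hyu, hy⟩
    have hyr : y - r • x ∈ P := (Submodule.Quotient.eq (P.submoduleOf P')).1 hy
    refine ⟨weightedHomogeneousComponent w (u - t) r, ?_, ?_⟩
    · rw [← sub_eq_add_neg]
      exact weightedHomogeneousComponent_mem w r (u - t)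
    · refine (Submodule.Quotient.eq _).2 ?_
      rw [Submodule.mem_colon_singleton, sub_smul]
      have h1 := component_mem_of_isGradedSubmodule h.isInternal hP hyr u
      have hyu' : component h.isInternal u y = y := component_of_mem _ hyu
      rw [map_sub, component_smul h hx, hyu'] at h1
      have := sub_mem hyr h1
      rwa [sub_sub_sub_cancel_left] at this

/-- A Noetherian graded module has a finite graded filtration with shifted copies of `R/J` as
composition factors, where each `J` is a graded prime with `f ∈ J` for every homogeneous `f` that
acts nilpotently. -/
theorem hasGradedFiltration_of_isNoetherian [IsNoetherian (MvPolynomial (Fin n) ℂ) M]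
    (h : IsGradedModule w ℳ) :
    HasGradedFiltration (polyGrading w) (fun J => IsGradedPrime w J ∧
      ∀ (f : MvPolynomial (Fin n) ℂ) (u : G), f ∈ polyGrading w u →
        (∃ r : ℕ, ∀ m : M, f ^ r • m = 0) → f ∈ J) ℳ := by
  set 𝒥 : Ideal (MvPolynomial (Fin n) ℂ) → Prop := fun J => IsGradedPrime w J ∧
      ∀ (f : MvPolynomial (Fin n) ℂ) (u : G), f ∈ polyGrading w u →
        (∃ r : ℕ, ∀ m : M, f ^ r • m = 0) → f ∈ J
  let Factor : Submodule (MvPolynomial (Fin n) ℂ) M → Submodule (MvPolynomial (Fin n) ℂ) M → Prop :=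
    fun P P' => ∃ (J : Ideal (MvPolynomial (Fin n) ℂ)) (s : G), 𝒥 J ∧
      GradedIso (MvPolynomial (Fin n) ℂ) (shiftGrading s (quotGrading (polyGrading w) J))
        (quotGrading (subGrading ℳ P') (P.submoduleOf P'))
  let S : Set (Submodule (MvPolynomial (Fin n) ℂ) M) :=
    {Q | ∃ (r : ℕ) (P : ℕ → Submodule (MvPolynomial (Fin n) ℂ) M), P 0 = ⊥ ∧ P r = Q ∧
      Monotone P ∧ (∀ i, IsGradedSubmodule ℳ (P i)) ∧ ∀ i < r, Factor (P i) (P (i + 1))}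
  have hS : S.Nonempty := by
    refine ⟨⊥, 0, fun _ => ⊥, rfl, rfl, monotone_const, fun _ => ?_, fun i hi => by omega⟩
    refine isGradedSubmodule_of_component_mem h.isInternal fun m hm u => ?_
    rw [(Submodule.mem_bot _).1 hm, map_zero]
    exact zero_mem _
  obtain ⟨Q, ⟨r, P, h0, hr, hmono, hgr, hfac⟩, hmax⟩ :=
    set_has_maximal_iff_noetherian.2 inferInstance S hS
  by_cases hQ : Q = ⊤
  · exact ⟨r, P, h0, hr.trans hQ, hmono, hgr, hfac⟩
  have hQgr : IsGradedSubmodule ℳ Q := hr ▸ hgr r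
  obtain ⟨t, x, hx, hxQ, hprime⟩ := exists_isGradedPrime_colon h hQgr hQ
  set Q' := Q ⊔ Submodule.span (MvPolynomial (Fin n) ℂ) {x} with hQ'
  have hQQ' : Q < Q' := lt_of_le_of_ne le_sup_left fun heq =>
    hxQ (heq ▸ Submodule.mem_sup_right (Submodule.mem_span_singleton_self x))
  have hstep : Factor Q Q' := by
    refine ⟨Q.colon {x}, -t, ⟨hprime, ?_⟩, gradedIso_sup_span h hQgr hx hQ'⟩
    rintro f u hf ⟨k, hk⟩
    refine hprime.mem_of_pow_mem hf (r := k) ?_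
    rw [Submodule.mem_colon_singleton, hk]
    exact zero_mem _
  have hle : ∀ i ≤ r, P i ≤ Q' := fun i hi => (hmono hi).trans (hr.le.trans hQQ'.le)
  refine absurd hQQ' (hmax Q' ⟨r + 1, fun i => if i ≤ r then P i else Q', ?_, ?_, ?_, ?_, ?_⟩)
  · simpa using h0
  · simp
  · intro i j hij
    dsimp only
    split_ifs with hi hj
    · exact hmono hij
    · exact hle i hi
    · omega
    · exact le_rfl
  · intro i
    dsimp only
    split_ifs
    · exact hgr i
    · exact isGradedSubmodule_sup_span h hQgr hx
  · intro i hi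
    dsimp only
    rcases Nat.lt_succ_iff_lt_or_eq.1 hi with hi | rfl
    · rw [if_pos hi.le, if_pos (Nat.succ_le_of_lt hi)]
      exact hfac i hi
    · rw [if_pos le_rfl, if_neg (by omega), hr]
      exact hstep

end Filtration

/-! ### Faces of the cone and rational relations -/

section Cone

/-- Finitely many positive real numbers are sent to positive rationals by some `ℚ`-linear map
`ℝ → ℚ`: such maps are given by prescribing rational values on a Hamel basis, and it suffices to
prescribe values close to the basis elements themselves. -/
lemma exists_linearMap_rat_pos (s : Finset ℝ) (hs : ∀ x ∈ s, 0 < x) :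
    ∃ φ : ℝ →ₗ[ℚ] ℚ, ∀ x ∈ s, 0 < φ x := by
  let b := Module.Basis.ofVectorSpace ℚ ℝ
  -- The assignments of real values to the basis elements whose linear extension is positive on `s`.
  let U : Set (Module.Basis.ofVectorSpaceIndex ℚ ℝ → ℝ) :=
    {t | ∀ x ∈ s, 0 < ∑ k ∈ (b.repr x).support, ((b.repr x k : ℚ) : ℝ) * t k}
  have hU : IsOpen U := by
    have : U = ⋂ x ∈ s, {t | 0 < ∑ k ∈ (b.repr x).support, ((b.repr x k : ℚ) : ℝ) * t k} := by
      ext t; simp [U]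
    rw [this]
    exact isOpen_biInter_finset fun x _ => isOpen_lt continuous_const (by fun_prop)
  have hb : (fun k => b k) ∈ U := by
    intro x hx
    have hxsum := b.linearCombination_repr x
    rw [Finsupp.linearCombination_apply, Finsupp.sum] at hxsum
    simp only [Rat.smul_def] at hxsum
    rw [hxsum]
    exact hs x hx
  obtain ⟨q, hq⟩ := (DenseRange.piMap (ι := Module.Basis.ofVectorSpaceIndex ℚ ℝ)
    fun _ => Rat.denseRange_cast (𝕜 := ℝ)).exists_mem_open hU ⟨_, hb⟩
  refine ⟨Finsupp.linearCombination ℚ q ∘ₗ b.repr.toLinearMap, fun x hx => ?_⟩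
  have := hq x hx
  rw [LinearMap.comp_apply, LinearEquiv.coe_coe, Finsupp.linearCombination_apply, Finsupp.sum]
  simp only [Pi.map_apply] at this
  simp only [smul_eq_mul]
  exact_mod_cast this

lemma exists_nat_eq_mul_of_nonneg {ι : Type*} [Fintype ι] (f : ι → ℚ) (hf : ∀ i, 0 ≤ f i) :
    ∃ (D : ℕ) (u : ι → ℕ), 0 < D ∧ ∀ i, (u i : ℚ) = D * f i := by
  refine ⟨∏ i, (f i).den, fun i => (∏ i, (f i).den) / (f i).den * (f i).num.toNat,
    Finset.prod_pos fun i _ => (f i).den_pos, fun i => ?_⟩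
  have hdvd : (f i).den ∣ ∏ i, (f i).den := Finset.dvd_prod_of_mem _ (Finset.mem_univ i)
  have hnum : (((f i).num.toNat : ℕ) : ℚ) = (f i).num := by
    exact_mod_cast Int.toNat_of_nonneg (Rat.num_nonneg.2 (hf i))
  have hden : ((f i).den : ℚ) ≠ 0 := by exact_mod_cast (f i).den_nz
  rw [Nat.cast_mul, Nat.cast_div hdvd hden, hnum]
  conv_rhs => rw [← Rat.num_div_den (f i)]
  ring

variable {n d : ℕ}

lemma mem_hull_image_iff {v : Fin n → Fin d → ℝ} {s : Set (Fin n)} {x : Fin d → ℝ} :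
    x ∈ PointedCone.hull ℝ (v '' s) ↔
      ∃ c : Fin n → ℝ, (∀ j, 0 ≤ c j) ∧ (∀ j ∉ s, c j = 0) ∧ ∑ j, c j • v j = x := by
  classical
  rw [PointedCone.hull, Finsupp.mem_span_image_iff_linearCombination]
  constructor
  · rintro ⟨l, hl, rfl⟩
    refine ⟨fun j => l j, fun j => (l j).2, fun j hj => ?_, ?_⟩
    · exact congrArg Subtype.val ((Finsupp.mem_supported' _ l).1 hl j hj)
    · rw [Finsupp.linearCombination_apply, Finsupp.sum_fintype _ _ (by simp)]
      rfl
  · rintro ⟨c, hc, hcs, rfl⟩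
    refine ⟨Finsupp.equivFunOnFinite.symm fun j => ⟨c j, hc j⟩, ?_, ?_⟩
    · rw [Finsupp.mem_supported']
      intro j hj
      exact Subtype.ext (hcs j hj)
    · rw [Finsupp.linearCombination_apply, Finsupp.sum_fintype _ _ (by simp)]
      rfl

variable {A : Fin n → Fin d → ℤ} {σ : Set (Fin n)}

/-- A set of generators that is a face of the semigroup `ℕA` is a face of the real cone `ℝ≥0 A`: a
relation with real coefficients is replaced by one with natural number coefficients and the same
supports. -/
lemma eq_zero_of_sum_smul_eq
    (hσ : ∀ u v : Fin n →₀ ℕ, Finsupp.weight A u = Finsupp.weight A v → (∀ j ∉ σ, u j = 0) →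
      ∀ j ∉ σ, v j = 0)
    {p q : Fin n → ℝ} (hp : ∀ j, 0 ≤ p j) (hq : ∀ j, 0 ≤ q j)
    (hpq : ∑ j, p j • toReal (A j) = ∑ j, q j • toReal (A j)) (hpσ : ∀ j ∉ σ, p j = 0) :
    ∀ j ∉ σ, q j = 0 := by
  classical
  obtain ⟨φ, hφ⟩ := exists_linearMap_rat_pos
    ((Finset.univ.image p ∪ Finset.univ.image q).filter fun x => 0 < x)
    fun x hx => (Finset.mem_filter.1 hx).2
  have hφp : ∀ j, 0 < p j → 0 < φ (p j) := fun j hj => hφ _ (by simp [hj])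
  have hφq : ∀ j, 0 < q j → 0 < φ (q j) := fun j hj => hφ _ (by simp [hj])
  have hnn : ∀ (c : Fin n → ℝ), (∀ j, 0 ≤ c j) → (∀ j, 0 < c j → 0 < φ (c j)) →
      ∀ j, 0 ≤ φ (c j) := by
    intro c hc hφc j
    rcases (hc j).eq_or_lt with h | h
    · rw [← h, map_zero]
    · exact (hφc j h).le
  have hφsum : ∀ i, ∑ j, φ (p j) * (A j i : ℚ) = ∑ j, φ (q j) * (A j i : ℚ) := by
    intro i
    have hcomm : ∀ c : Fin n → ℝ,
        φ ((∑ j, c j • toReal (A j)) i) = ∑ j, φ (c j) * (A j i : ℚ) := by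
      intro c
      rw [Finset.sum_apply, map_sum]
      refine Finset.sum_congr rfl fun j _ => ?_
      have : (c j • toReal (A j)) i = (A j i : ℤ) • c j := by
        simp [toReal, mul_comm]
      rw [this, map_zsmul, zsmul_eq_mul, mul_comm]
    rw [← hcomm, ← hcomm, hpq]
  obtain ⟨D, u, hD, hu⟩ := exists_nat_eq_mul_of_nonneg
    (Sum.elim (fun j => φ (p j)) fun j => φ (q j))
    (Sum.rec (hnn p hp hφp) (hnn q hq hφq))
  have hD' : (D : ℚ) ≠ 0 := by exact_mod_cast hD.ne'
  have hup : ∀ j, (u (.inl j) : ℚ) = D * φ (p j) := fun j => hu (.inl j)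
  have huq : ∀ j, (u (.inr j) : ℚ) = D * φ (q j) := fun j => hu (.inr j)
  intro j hj
  have key := hσ (Finsupp.equivFunOnFinite.symm fun j => u (.inl j))
    (Finsupp.equivFunOnFinite.symm fun j => u (.inr j)) ?_ ?_ j hj
  · by_contra hne
    have hpos := hφq j (lt_of_le_of_ne (hq j) (Ne.symm hne))
    have h0 : (u (.inr j) : ℚ) = 0 := by exact_mod_cast key
    rw [huq] at h0
    exact hpos.ne' ((mul_eq_zero.1 h0).resolve_left hD')
  · ext i
    rw [Finsupp.weight_apply, Finsupp.weight_apply, Finsupp.sum_fintype _ _ (by simp),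
      Finsupp.sum_fintype _ _ (by simp), Finset.sum_apply, Finset.sum_apply]
    have : (∑ j, (u (.inl j) : ℚ) * (A j i : ℚ)) = ∑ j, (u (.inr j) : ℚ) * (A j i : ℚ) := by
      simp_rw [hup, huq, mul_assoc, ← Finset.mul_sum]
      rw [hφsum]
    simp only [Finsupp.equivFunOnFinite_symm_apply_apply, Pi.smul_apply, nsmul_eq_mul]
    exact_mod_cast this
  · intro k hk
    have h0 : (u (.inl k) : ℚ) = 0 := by rw [hup, hpσ k hk, map_zero, mul_zero]
    exact_mod_cast h0

/-- The face of `ℝ≥0 A` spanned by a face of the semigroup `ℕA` contains no further generator. -/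
lemma exists_isFaceOf_realCone
    (hσ : ∀ u v : Fin n →₀ ℕ, Finsupp.weight A u = Finsupp.weight A v → (∀ j ∉ σ, u j = 0) →
      ∀ j ∉ σ, v j = 0) :
    ∃ τ : PointedCone ℝ (Fin d → ℝ), τ.IsFaceOf (realCone A) ∧ ∀ j, toReal (A j) ∈ τ ↔ j ∈ σ := by
  classical
  refine ⟨PointedCone.hull ℝ ((fun j => toReal (A j)) '' σ), ⟨?_, ?_⟩, fun j => ⟨fun h => ?_,
    fun h => PointedCone.subset_hull ⟨j, h, rfl⟩⟩⟩
  · exact Submodule.span_mono (Set.image_subset_range _ _)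
  · intro x y r hx hy hr hxy
    rw [realCone, ← Set.image_univ, mem_hull_image_iff] at hx hy
    rw [mem_hull_image_iff] at hxy ⊢
    obtain ⟨c, hc, -, rfl⟩ := hx
    obtain ⟨e, he, -, rfl⟩ := hy
    obtain ⟨p, hp, hpσ, hsum⟩ := hxy
    refine ⟨c, hc, fun j hj => ?_, rfl⟩
    have hq := eq_zero_of_sum_smul_eq hσ hp (q := fun j => r * c j + e j)
      (fun j => add_nonneg (mul_nonneg hr.le (hc j)) (he j)) ?_ hpσ j hj
    · have h1 := mul_nonneg hr.le (hc j)
      have h2 : r * c j = 0 := by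
        have := he j
        linarith
      exact (mul_eq_zero.1 h2).resolve_left hr.ne'
    · rw [hsum, Finset.smul_sum, ← Finset.sum_add_distrib]
      exact Finset.sum_congr rfl fun j _ => by rw [add_smul, mul_smul]
  · obtain ⟨p, hp, hpσ, hsum⟩ := mem_hull_image_iff.1 h
    by_contra hj
    have := eq_zero_of_sum_smul_eq hσ hp (q := Pi.single j 1)
      (fun k => by rw [Pi.single_apply]; split_ifs <;> norm_num) ?_ hpσ j hj
    · rw [Pi.single_eq_same] at this
      exact one_ne_zero this
    · rw [hsum, Finset.sum_eq_single j]
      · rw [Pi.single_eq_same, one_smul]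
      · intro k _ hk
        rw [Pi.single_eq_of_ne hk, zero_smul]
      · exact fun h => absurd (Finset.mem_univ j) h

end Cone

/-! ### Graded primes containing the toric ideal -/

section FacePrimes

variable {n : ℕ} {G : Type*} [AddCommGroup G] {w : Fin n → G}

lemma expDiff_mem_relationLattice_iff {u v : Fin n →₀ ℕ} :
    expDiff u v ∈ relationLattice w ↔ Finsupp.weight w u = Finsupp.weight w v := by
  rw [relationLattice, LinearMap.mem_ker, Fintype.linearCombination_apply, Finsupp.weight_apply,
    Finsupp.weight_apply, Finsupp.sum_fintype _ _ (by simp), Finsupp.sum_fintype _ _ (by simp),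
    ← sub_eq_zero (a := ∑ i, u i • w i), ← Finset.sum_sub_distrib]
  simp only [expDiff, sub_smul, natCast_zsmul]

lemma exists_expDiff_eq (x : Fin n → ℤ) :
    ∃ u v : Fin n →₀ ℕ, expDiff u v = x ∧ ∀ j, x j = 0 → v j = 0 := by
  refine ⟨Finsupp.equivFunOnFinite.symm fun j => (x j).toNat,
    Finsupp.equivFunOnFinite.symm fun j => (-x j).toNat, ?_, fun j hj => ?_⟩
  · ext j
    simp only [expDiff, Finsupp.equivFunOnFinite_symm_apply_apply]
    omega
  · simp [hj]

lemma expDiff_add (u v u' v' : Fin n →₀ ℕ) :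
    expDiff (u + u') (v + v') = expDiff u v + expDiff u' v' := by
  ext j
  simp only [expDiff, Finsupp.add_apply, Pi.add_apply, Nat.cast_add]
  ring

lemma monomial_eq_C_mul (u : Fin n →₀ ℕ) (z : ℂ) : monomial u z = C z * monomial u 1 := by
  rw [C_mul_monomial, mul_one]

/-- The binomial `∂^{Nu} - ∂^{Nv}` factors into the binomials `∂^u - ζ ∂^v` with `ζ ∈ ℂ` an `N`-th
root of unity. -/
lemma monomial_nsmul_sub_eq_prod {N : ℕ} (hN : N ≠ 0) (u v : Fin n →₀ ℕ) :
    ∃ s : Finset (MvPolynomial (Fin n) ℂ), (∀ ξ ∈ s, ∃ ζ : ℂˣ, ξ = C (ζ : ℂ)) ∧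
      (monomial (N • u) 1 - monomial (N • v) 1 : MvPolynomial (Fin n) ℂ) =
        ∏ ξ ∈ s, (monomial u 1 - ξ * monomial v 1) := by
  have hprim := Complex.isPrimitiveRoot_exp N hN
  have hprim' := hprim.map_of_injective (C_injective (Fin n) ℂ)
  have : NeZero N := ⟨hN⟩
  refine ⟨Polynomial.nthRootsFinset N 1, fun ξ hξ => ?_, ?_⟩
  · rw [Polynomial.mem_nthRootsFinset (Nat.pos_of_ne_zero hN)] at hξ
    obtain ⟨i, -, rfl⟩ := hprim'.eq_pow_of_pow_eq_one hξ
    exact ⟨(hprim.isUnit hN).unit ^ i, by simp⟩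
  · rw [← hprim'.pow_sub_pow_eq_prod_sub_mul _ _ (Nat.pos_of_ne_zero hN), monomial_pow,
      monomial_pow, one_pow]

variable {J : Ideal (MvPolynomial (Fin n) ℂ)}

lemma monomial_mem_of_X_mem {j : Fin n} (hj : X j ∈ J) {u : Fin n →₀ ℕ} (hu : u j ≠ 0) (z : ℂ) :
    monomial u z ∈ J :=
  J.mem_of_dvd (X_dvd_monomial.2 (Or.inr hu)) hj

lemma C_mul_mem_iff (J : Ideal (MvPolynomial (Fin n) ℂ)) {z : ℂ} (hz : z ≠ 0)
    {p : MvPolynomial (Fin n) ℂ} : C z * p ∈ J ↔ p ∈ J :=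
  Ideal.unit_mul_mem_iff_mem J ((isUnit_iff_ne_zero.2 hz).map C)

/-- The factor of proportionality is unique for monomials outside of `J`. -/
lemma eq_of_monomial_sub_mem {u v : Fin n →₀ ℕ} (hv : monomial v 1 ∉ J)
    {z z' : ℂ} (h : monomial u 1 - monomial v z ∈ J) (h' : monomial u 1 - monomial v z' ∈ J) :
    z = z' := by
  by_contra hne
  refine hv ((C_mul_mem_iff J (sub_ne_zero.2 hne)).1 ?_)
  have := sub_mem h' h
  rwa [sub_sub_sub_cancel_left, ← map_sub, monomial_eq_C_mul] at this

namespace IsGradedPrime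

lemma exists_X_mem (hJ : IsGradedPrime w J) {u : Fin n →₀ ℕ} (h : monomial u 1 ∈ J) :
    ∃ j, u j ≠ 0 ∧ X j ∈ J := by
  rw [monomial_eq, C_1, one_mul, Finsupp.prod] at h
  obtain ⟨j, hj, hjJ⟩ := hJ.exists_mem_of_prod_mem
    (fun j _ => IsWeightedHomogeneous.pow (isWeightedHomogeneous_X ℂ w j) (u j)) h
  exact ⟨j, Finsupp.mem_support_iff.1 hj, hJ.mem_of_pow_mem (isWeightedHomogeneous_X ℂ w j) hjJ⟩

/-- The monomials outside of a graded prime are multiplicatively closed. -/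
lemma monomial_add_notMem (hJ : IsGradedPrime w J) {u v : Fin n →₀ ℕ} (hu : monomial u 1 ∉ J)
    (hv : monomial v 1 ∉ J) : monomial (u + v) 1 ∉ J := by
  intro h
  have hmul : (monomial (u + v) 1 : MvPolynomial (Fin n) ℂ) = monomial u 1 * monomial v 1 := by
    rw [monomial_mul, one_mul]
  rw [hmul] at h
  exact (hJ.mem_or_mem (monomial_mem_polyGrading u 1) (monomial_mem_polyGrading v 1) h).elim hu hv

lemma monomial_mem_of_weight_eq (hJ : IsGradedPrime w J) {N : ℕ} (hN : N ≠ 0)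
    (H : ∀ u v : Fin n →₀ ℕ, Finsupp.weight w u = Finsupp.weight w v →
      (monomial (N • u) 1 - monomial (N • v) 1 : MvPolynomial (Fin n) ℂ) ∈ J)
    {u v : Fin n →₀ ℕ} (huv : Finsupp.weight w u = Finsupp.weight w v) (hu : monomial u 1 ∈ J) :
    monomial v 1 ∈ J := by
  refine hJ.mem_of_pow_mem (monomial_mem_polyGrading v 1) (r := N) ?_
  have h := H u v huv
  have hpow : ∀ u : Fin n →₀ ℕ, (monomial (N • u) 1 : MvPolynomial (Fin n) ℂ) =
      monomial u 1 ^ N := fun u => by rw [monomial_pow, one_pow]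
  rw [hpow, hpow] at h
  exact (Submodule.sub_mem_iff_right J (Ideal.pow_mem_of_mem J hu N (Nat.pos_of_ne_zero hN))).1 h

/-- Monomials of equal degree are proportional modulo a graded prime. -/
lemma exists_monomial_sub_mem (hJ : IsGradedPrime w J) {N : ℕ} (hN : N ≠ 0)
    (H : ∀ u v : Fin n →₀ ℕ, Finsupp.weight w u = Finsupp.weight w v →
      (monomial (N • u) 1 - monomial (N • v) 1 : MvPolynomial (Fin n) ℂ) ∈ J)
    {u v : Fin n →₀ ℕ} (huv : Finsupp.weight w u = Finsupp.weight w v) :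
    ∃ ζ : ℂˣ, monomial u 1 - monomial v (ζ : ℂ) ∈ J := by
  obtain ⟨s, hs, hprod⟩ := monomial_nsmul_sub_eq_prod hN u v
  have h := H u v huv
  rw [hprod] at h
  have hdeg : ∀ ξ ∈ s, monomial u 1 - ξ * monomial v 1 ∈
      polyGrading w (Finsupp.weight w u) := by
    intro ξ hξ
    obtain ⟨ζ, rfl⟩ := hs ξ hξ
    rw [← monomial_eq_C_mul]
    exact sub_mem (monomial_mem_polyGrading u 1) (huv ▸ monomial_mem_polyGrading v _)
  obtain ⟨ξ, hξ, hmem⟩ := hJ.exists_mem_of_prod_mem hdeg h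
  obtain ⟨ζ, rfl⟩ := hs ξ hξ
  exact ⟨ζ, by rwa [monomial_eq_C_mul v]⟩

end IsGradedPrime

/-- `ℂˣ` is divisible, so a partial character on a subgroup extends to the whole group. -/
lemma exists_addMonoidHom_extension {L : Type*} [AddCommGroup L] (K : AddSubgroup L)
    (f : K →+ Additive ℂˣ) : ∃ g : L →+ Additive ℂˣ, ∀ x : K, g x = f x := by
  have hdiv : ∀ {k : ℕ}, k ≠ 0 → Function.Surjective fun z : Additive ℂˣ => k • z := by
    intro k hk z
    obtain ⟨y, hy⟩ := IsAlgClosed.exists_pow_nat_eq ((z.toMul : ℂˣ) : ℂ) (Nat.pos_of_ne_zero hk)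
    have hy0 : y ≠ 0 := by
      rintro rfl
      rw [zero_pow hk] at hy
      exact (z.toMul).ne_zero hy.symm
    refine ⟨Additive.ofMul (Units.mk0 y hy0), ?_⟩
    apply Additive.toMul.injective
    ext
    simpa using hy
  let _ : DivisibleBy (Additive ℂˣ) ℕ := divisibleByOfSMulRightSurj _ _ hdiv
  let _ : DivisibleBy (Additive ℂˣ) ℤ := AddGroup.divisibleByIntOfDivisibleByNat _
  obtain ⟨g, hg⟩ := (Module.Baer.of_divisible (Additive ℂˣ)).extension_property_addMonoidHom
    K.subtype K.subtype_injective f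
  exact ⟨g, fun x => DFunLike.congr_fun hg x⟩

namespace IsGradedPrime

/-- The factors of proportionality between the monomials of equal degree outside of a graded prime
form a partial character, which extends to a character of the relation lattice. -/
lemma exists_character (hJ : IsGradedPrime w J) {N : ℕ} (hN : N ≠ 0)
    (H : ∀ u v : Fin n →₀ ℕ, Finsupp.weight w u = Finsupp.weight w v →
      (monomial (N • u) 1 - monomial (N • v) 1 : MvPolynomial (Fin n) ℂ) ∈ J) :
    ∃ ρ : AddChar (relationLattice w) ℂˣ, ∀ (u v : Fin n →₀ ℕ)
      (h : expDiff u v ∈ relationLattice w), monomial v 1 ∉ J →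
        monomial u 1 - monomial v ((ρ ⟨expDiff u v, h⟩ : ℂˣ) : ℂ) ∈ J := by
  -- The relations among the degrees of the variables outside of `J`.
  let K : AddSubgroup (relationLattice w) :=
    { carrier := {x | ∀ j, X j ∈ J → (x : Fin n → ℤ) j = 0}
      add_mem' := fun {x y} hx hy j hj => by
        rw [Submodule.coe_add, Pi.add_apply, hx j hj, hy j hj, add_zero]
      zero_mem' := fun j _ => rfl
      neg_mem' := fun {x} hx j hj => by
        rw [Submodule.coe_neg, Pi.neg_apply, hx j hj, neg_zero] }
  -- `Q x ζ`: the value of the partial character at `x` is `ζ`.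
  let Q : (Fin n → ℤ) → ℂˣ → Prop := fun x ζ => ∃ u v : Fin n →₀ ℕ, expDiff u v = x ∧
    monomial v 1 ∉ J ∧ monomial u 1 - monomial v (ζ : ℂ) ∈ J
  have hadd : ∀ {x y ζ ξ}, Q x ζ → Q y ξ → Q (x + y) (ζ * ξ) := by
    rintro _ _ ζ ξ ⟨u, v, rfl, hv, huv⟩ ⟨u', v', rfl, hv', huv'⟩
    refine ⟨u + u', v + v', expDiff_add u v u' v', hJ.monomial_add_notMem hv hv', ?_⟩
    have : (monomial (u + u') 1 - monomial (v + v') ((ζ * ξ : ℂˣ) : ℂ) : MvPolynomial (Fin n) ℂ) =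
        monomial u' 1 * (monomial u 1 - monomial v (ζ : ℂ)) +
          monomial v (ζ : ℂ) * (monomial u' 1 - monomial v' (ξ : ℂ)) := by
      simp only [mul_sub, monomial_mul, mul_one, one_mul, Units.val_mul, add_comm u' u,
        add_comm u' v]
      ring
    rw [this]
    exact add_mem (J.mul_mem_left _ huv) (J.mul_mem_left _ huv')
  have huniq : ∀ {x ζ ξ}, Q x ζ → Q x ξ → ζ = ξ := by
    rintro x ζ ξ ⟨u, v, rfl, hv, huv⟩ ⟨u', v', hx, hv', huv'⟩
    have hsum : u + v' = u' + v := by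
      ext j
      have := congrFun hx j
      simp only [expDiff] at this
      simp only [Finsupp.add_apply]
      omega
    refine Units.ext (eq_of_monomial_sub_mem (u := u + v') (hJ.monomial_add_notMem hv hv') ?_ ?_)
    · have := J.mul_mem_right (monomial v' 1) huv
      simpa only [sub_mul, monomial_mul, mul_one] using this
    · have := J.mul_mem_right (monomial v 1) huv'
      simpa only [sub_mul, monomial_mul, mul_one, ← hsum, add_comm v' v] using this
  have hex : ∀ x : K, ∃ ζ, Q (x : relationLattice w) ζ := by
    rintro ⟨⟨x, hxL⟩, hx⟩
    obtain ⟨u, v, rfl, hv⟩ := exists_expDiff_eq x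
    obtain ⟨ζ, hζ⟩ := hJ.exists_monomial_sub_mem hN H (expDiff_mem_relationLattice_iff.1 hxL)
    refine ⟨ζ, u, v, rfl, fun hmem => ?_, hζ⟩
    obtain ⟨j, hj, hjJ⟩ := hJ.exists_X_mem hmem
    exact hj (hv j (hx j hjJ))
  choose f hf using hex
  obtain ⟨g, hg⟩ := exists_addMonoidHom_extension K
    (AddMonoidHom.mk' (fun x => Additive.ofMul (f x)) fun x y =>
      congrArg Additive.ofMul (huniq (hf (x + y)) (hadd (hf x) (hf y))))
  refine ⟨AddChar.toAddMonoidHomEquiv.symm g, fun u v h hv => ?_⟩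
  have huv := expDiff_mem_relationLattice_iff.1 h
  have hu : monomial u 1 ∉ J := fun hu => hv (hJ.monomial_mem_of_weight_eq hN H huv hu)
  have hzero : ∀ {s : Fin n →₀ ℕ}, monomial s 1 ∉ J → ∀ j, X j ∈ J → s j = 0 := by
    intro s hs j hj
    by_contra hne
    exact hs (monomial_mem_of_X_mem hj hne 1)
  have hK : (⟨expDiff u v, h⟩ : relationLattice w) ∈ K := fun j hj => by
    simp [expDiff, hzero hu j hj, hzero hv j hj]
  obtain ⟨ζ, hζ⟩ := hJ.exists_monomial_sub_mem hN H huv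
  have hval : AddChar.toAddMonoidHomEquiv.symm g ⟨expDiff u v, h⟩ = ζ := by
    have h1 : g ⟨expDiff u v, h⟩ = Additive.ofMul (f ⟨_, hK⟩) := hg ⟨_, hK⟩
    have h2 : f ⟨_, hK⟩ = ζ := huniq (hf ⟨_, hK⟩) ⟨u, v, rfl, hv, hζ⟩
    rw [← h2]
    exact congrArg Additive.toMul h1
  rw [hval]
  exact hζ

end IsGradedPrime

/-- A graded prime of `R_A` that contains the `N`-th power binomials `∂^{Nu} - ∂^{Nv}` of all
relations among the degrees is one of the ideals `I^τ_{A,ρ}`. -/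
theorem IsGradedPrime.exists_eq_faceIdeal {d : ℕ} {A : Fin n → Fin d → ℤ}
    (hJ : IsGradedPrime A J) {N : ℕ} (hN : N ≠ 0)
    (H : ∀ u v : Fin n →₀ ℕ, Finsupp.weight A u = Finsupp.weight A v →
      (monomial (N • u) 1 - monomial (N • v) 1 : MvPolynomial (Fin n) ℂ) ∈ J) :
    ∃ (τ : PointedCone ℝ (Fin d → ℝ)) (ρ : AddChar (relationLattice A) ℂˣ),
      τ.IsFaceOf (realCone A) ∧ J = faceIdeal A τ ρ := by
  obtain ⟨ρ, hρ⟩ := hJ.exists_character hN H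
  obtain ⟨τ, hτ, hmem⟩ := exists_isFaceOf_realCone (A := A) (σ := {j | X j ∉ J}) (by
    intro u v huv hu j hj
    by_contra hne
    obtain ⟨k, hk, hkJ⟩ := hJ.exists_X_mem (hJ.monomial_mem_of_weight_eq hN H huv.symm
      (monomial_mem_of_X_mem (not_not.1 hj) hne 1))
    exact hk (hu k (not_not.2 hkJ)))
  refine ⟨τ, ρ, hτ, ?_⟩
  have hle : faceIdeal A τ ρ ≤ J := by
    refine sup_le (Ideal.span_le.2 ?_) (Ideal.span_le.2 ?_)
    · rintro _ ⟨j, hj, rfl⟩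
      by_contra hjJ
      exact hj ((hmem j).2 hjJ)
    · rintro _ ⟨u, v, h, rfl⟩
      by_cases hv : monomial v 1 ∈ J
      · have hu := hJ.monomial_mem_of_weight_eq hN H
          (expDiff_mem_relationLattice_iff.1 h).symm hv
        refine sub_mem hu ?_
        rw [monomial_eq_C_mul]
        exact J.mul_mem_left _ hv
      · exact hρ u v h hv
  have hX : ∀ j, X j ∈ J → X j ∈ faceIdeal A τ ρ := fun j hj =>
    Ideal.mem_sup_left (Ideal.subset_span ⟨j, fun h => (hmem j).1 h hj, rfl⟩)
  have hbin : ∀ (u v : Fin n →₀ ℕ), Finsupp.weight A u = Finsupp.weight A v →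
      ∃ ζ : ℂ, monomial u 1 - monomial v ζ ∈ faceIdeal A τ ρ := fun u v huv =>
    ⟨_, Ideal.mem_sup_right (Ideal.subset_span
      ⟨u, v, expDiff_mem_relationLattice_iff.2 huv, rfl⟩)⟩
  have hhom : ∀ (e : Fin d → ℤ) (f : MvPolynomial (Fin n) ℂ), f ∈ polyGrading A e → f ∈ J →
      f ∈ faceIdeal A τ ρ := by
    intro e f hfe hfJ
    rcases f.support.eq_empty_or_nonempty with hf | ⟨s, hs⟩
    · rw [support_eq_empty.1 hf]
      exact zero_mem _
    -- Modulo `I^τ_{A,ρ}`, a homogeneous polynomial is a scalar multiple of each of its monomials.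
    have hred : ∃ z : ℂ, f - monomial s z ∈ faceIdeal A τ ρ := by
      have hterm : ∀ u ∈ f.support, ∃ z : ℂ,
          monomial u (coeff u f) - monomial s z ∈ faceIdeal A τ ρ := by
        intro u hu
        obtain ⟨ζ, hζ⟩ := hbin u s
          ((hfe (mem_support_iff.1 hu)).trans (hfe (mem_support_iff.1 hs)).symm)
        refine ⟨coeff u f * ζ, ?_⟩
        have := (faceIdeal A τ ρ).mul_mem_left (C (coeff u f)) hζ
        simpa only [mul_sub, C_mul_monomial, mul_one] using this
      choose! z hz using hterm
      refine ⟨∑ u ∈ f.support, z u, ?_⟩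
      have := sum_mem (S := faceIdeal A τ ρ) hz
      rwa [Finset.sum_sub_distrib, support_sum_monomial_coeff, ← map_sum] at this
    obtain ⟨z, hz⟩ := hred
    have hzJ : monomial s z ∈ J := by
      have := sub_mem hfJ (hle hz)
      rwa [sub_sub_cancel] at this
    have hzI : monomial s z ∈ faceIdeal A τ ρ := by
      by_cases hz0 : z = 0
      · rw [hz0, map_zero]
        exact zero_mem _
      · rw [monomial_eq_C_mul, C_mul_mem_iff J hz0] at hzJ
        obtain ⟨j, hj, hjJ⟩ := hJ.exists_X_mem hzJ
        exact monomial_mem_of_X_mem (hX j hjJ) hj z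
    have := add_mem hz hzI
    rwa [sub_add_cancel] at this
  refine le_antisymm (fun f hf => ?_) hle
  rw [← finsum_weightedHomogeneousComponent (w := A) f]
  exact finsum_induction (· ∈ faceIdeal A τ ρ) (zero_mem _) (fun _ _ => add_mem) fun u =>
    hhom u _ (weightedHomogeneousComponent_mem A f u) (hJ.component_mem f hf u)

end FacePrimes

/-! ### From graded primes to the modules `R_A / I^τ_{A,ρ}` -/

lemma card_nsmul_eq_of_proj_eq {F : Type*} [AddCommGroup F] {d : ℕ}
    {x y : F × (Fin d → ℤ)} (h : proj F d x = proj F d y) :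
    Nat.card F • x = Nat.card F • y :=
  Prod.ext (by rw [Prod.smul_fst, Prod.smul_fst, card_nsmul_eq_zero', card_nsmul_eq_zero'])
    (congrArg (Nat.card F • ·) h)

end TorsionToric

open TorsionToric in
theorem mainTheorem6 {F : Type*} [AddCommGroup F] [Finite F] [DecidableEq F] {n d : ℕ}
    (a : Fin n → F × (Fin d → ℤ))
    (hspan : AddSubgroup.closure (Set.range fun j => TorsionToric.proj F d (a j)) = ⊤)
    (hpointed : ∀ x ∈ TorsionToric.realCone (fun j => TorsionToric.proj F d (a j)),
      -x ∈ TorsionToric.realCone (fun j => TorsionToric.proj F d (a j)) → x = 0)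
    {M : Type*} [AddCommGroup M] [Module (MvPolynomial (Fin n) ℂ) M]
    (ℳ : F × (Fin d → ℤ) → AddSubgroup M) (hM : TorsionToric.IsToric a ℳ) :
    TorsionToric.IsTtoric (fun j => TorsionToric.proj F d (a j))
      (TorsionToric.coarsen (TorsionToric.proj F d) ℳ) := by
  obtain ⟨hgraded, hfilt⟩ := hM
  have hcoarse := hgraded.coarsen (proj F d)
  have := hfilt.isNoetherian
  obtain ⟨r, P, h0, hr, hmono, hgr, hfac⟩ := hasGradedFiltration_of_isNoetherian hcoarse
  refine ⟨hcoarse, r, P, h0, hr, hmono, hgr, fun i hi => ?_⟩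
  obtain ⟨J, s, ⟨hJ, hnil⟩, e⟩ := hfac i hi
  refine ⟨J, s, hJ.exists_eq_faceIdeal (N := Nat.card F) Nat.card_pos.ne' ?_, e⟩
  intro u v huv
  rw [weight_comp, weight_comp] at huv
  -- Multiplication by `|F|` kills the torsion, so the relation lifts from `ℤᵈ` to `N`.
  have hlift : Finsupp.weight a (Nat.card F • u) = Finsupp.weight a (Nat.card F • v) := by
    rw [map_nsmul, map_nsmul, card_nsmul_eq_of_proj_eq huv]
  have hdeg : Finsupp.weight (fun j => proj F d (a j)) (Nat.card F • u) =
      Finsupp.weight (fun j => proj F d (a j)) (Nat.card F • v) := by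
    rw [weight_comp, weight_comp, hlift]
  refine hnil _ (Finsupp.weight (fun j => proj F d (a j)) (Nat.card F • u))
    (sub_mem (monomial_mem_polyGrading _ _) (hdeg ▸ monomial_mem_polyGrading _ _))
    (hfilt.exists_pow_smul_eq_zero fun I hI => hI.1 (Ideal.subset_span ?_))
  exact ⟨_, _, expDiff_mem_relationLattice_iff.2 hlift, rfl⟩
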